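/- **Theorem (homotopic faithfully flat descent).** Let $(\mathscr V,\otimes,\Bbbk)$ be a closed symmetric monoidal model category. Assume that for every algebra (monoid) $A$ in $\mathscr V$ the category $\mathscr V_A$ of right $A$-modules is equipped with a model structure whose weak equivalences are created by the forgetful functor $\mathscr V_A\to\mathscr V$, and that for every coring $(A,C)$ in $\mathscr V$ (an algebra $A$ and a comonoid $C$ in the monoidal category $({}_A\mathscr V_A,\otimes_A,A)$ of $A$-bimodules) the category $\mathscr V_A^C$ of right $(A,C)$-comodules is equipped with the model structure left-induced from $\mathscr V_A$: a morphism of $\mathscr V_A^C$ is a weak equivalence (resp. cofibration) if and only if the underlying morphism of $\mathscr V_A$ is one. Let $(A,C)$ be a flat coring, i.e. $-\otimes_A C\colon\mathscr V_A\to\mathscr V$ preserves coreflexive equalizers. Let $B$ be an algebra and let ${}_AX_B$ be a right dualizable bimodule: there are a bimodule ${}_BX^\vee_A$ and bimodule maps $u\colon A\to X\otimes_B X^\vee$, $e\colon X^\vee\otimes_A X\to B$ satisfying the triangle identities. Suppose that $-\otimes_A X\colon\mathscr V_A\to\mathscr V_B$ is a left Quillen functor, and that $X$ is homotopy faithfully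 flat as a left $A$-module, i.e. * $-\otimes_A X\colon\mathscr V_A\to\mathscr V$ preserves and reflects weak equivalences, and * for every finite category $\mathsf J$ and every functor $\Phi\colon\mathsf J\to\mathscr V_A$ the natural map $(\lim_{\mathsf J}\Phi)\otimes_A X\to\lim_{\mathsf J}(\Phi\otimes_A X)$ is a weak equivalence in $\mathscr V$. Let $X_*(C)=X^\vee\otimes_A C\otimes_A X$ be the canonical $B$-coring, with comultiplication $(1\otimes u\otimes 1)(1\otimes\Delta_C\otimes 1)$ (where $u$ is inserted between the two copies of $C$) and counit $e(1\otimes\epsilon_C\otimes 1)$, and let $\operatorname{Can}_X\colon\mathscr V_A^C\to\mathscr V_B^{X_*(C)}$ be the functor that sends $(M,\delta)$ to $M\otimes_A X$ with coaction $$M\otimes_A X\xrightarrow{\delta\otimes 1}M\otimes_A C\otimes_A X\xrightarrow{1\otimes u\otimes 1}M\otimes_A X\otimes_B X_*(C).$$ Then $X$ satisfies effective homotopic descent with respect to $(A,C)$: the functor $\operatorname{Can}_X$ has a right adjoint $\operatorname{Prim}_X$, and the adjunction $\operatorname{Can}_X\dashv\operatorname{Prim}_X$ is a Quillen equivalence.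 -/

import Mathlib

universe w v u

open CategoryTheory

namespace HomotopicDescent

/-!
Corings, comodules and braided bimodules.  Everything in this section is stated in a bicategory;
it is used below for the bicategory of algebras and bimodules in `V`, in which `X ≫ Y` is the
tensor product `X ⊗_B Y` of an `A`-`B`-bimodule and a `B`-`C`-bimodule, and `𝟙 A` is the
`A`-bimodule `A`.  An `A`-coring is then a comonoid `C : Comon (A ⟶ A)` in the monoidal category
of `A`-bimodules.
-/

section Bicat
open Bicategory

variable {B : Type u} [Bicategory.{w, v} B] {a b : B}

/-- The natural map `1 ⊗ ε : M ⊗_A C ⟶ M ⊗_A A ≅ M`. -/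
def comodCounit (e : B) (C : Comon (a ⟶ a)) : postcomp e C.X ⟶ 𝟭 (e ⟶ a) where
  app M := M ◁ Comonad.counit (t := C.X) ≫ (ρ_ M).hom
  naturality M N f := by
    simp [postcomp, ← whisker_exchange_assoc]

/-- The natural map `1 ⊗ Δ : M ⊗_A C ⟶ M ⊗_A (C ⊗_A C) ≅ (M ⊗_A C) ⊗_A C`. -/
def comodComul (e : B) (C : Comon (a ⟶ a)) :
    postcomp e C.X ⟶ postcomp e C.X ⋙ postcomp e C.X where
  app M := M ◁ Comonad.comul (t := C.X) ≫ (α_ M C.X C.X).inv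
  naturality M N f := by
    simp [postcomp, ← whisker_exchange_assoc]

/-- The comonad `- ⊗_A C` of a coring `C`.  Its coalgebras are the right `C`-comodules: objects `M`
with `δ : M ⟶ M ⊗_A C` such that `(1 ⊗ ε) δ = 1` and `(1 ⊗ Δ) δ = (δ ⊗ 1) δ`; the morphisms are
those commuting with `δ`. -/
def comodComonad (e : B) (C : Comon (a ⟶ a)) : CategoryTheory.Comonad (e ⟶ a) :=
  ⟨postcomp e C.X, comodCounit e C, comodComul e C,
  by
    intro M
    have h2 := congrArg (fun k => M ◁ k) (Comonad.comul_assoc_flip C.X)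
    simp only [Bicategory.whiskerLeft_comp] at h2
    simp [comodComul, postcomp, reassoc_of% h2],
  by
    intro M
    have h2 := congrArg (fun k => M ◁ k) (Comonad.comul_counit C.X)
    simp only [Bicategory.whiskerLeft_comp] at h2
    simp [comodComul, comodCounit, postcomp, reassoc_of% h2],
  by
    intro M
    have h2 := congrArg (fun k => M ◁ k) (Comonad.counit_comul C.X)
    simp only [Bicategory.whiskerLeft_comp] at h2
    simp [comodComul, comodCounit, postcomp, reassoc_of% h2]⟩

/-- A braiding `T : C ⊗_A X ⟶ X ⊗_B D`, satisfying the pentagon axiom and the counit axiom. -/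
structure Braiding (C : Comon (a ⟶ a)) (D : Comon (b ⟶ b)) (X : a ⟶ b) where
  /-- the underlying morphism of bimodules -/
  hom : C.X ≫ X ⟶ X ≫ D.X
  pentagon : Comonad.comul (t := C.X) ▷ X ≫ (α_ C.X C.X X).hom ≫ C.X ◁ hom ≫
      (α_ C.X X D.X).inv ≫ hom ▷ D.X ≫ (α_ X D.X D.X).hom =
    hom ≫ X ◁ Comonad.comul (t := D.X)
  counit_comp : hom ≫ X ◁ Comonad.counit (t := D.X) ≫ (ρ_ X).hom =
    Comonad.counit (t := C.X) ▷ X ≫ (λ_ X).hom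

variable (C : Comon (a ⟶ a)) {x : a ⟶ b} {y : b ⟶ a}

/-- For `x` with right dual `y`: the comultiplication
`Y ⊗ C ⊗ X ⟶ Y ⊗ C ⊗ C ⊗ X ⟶ (Y ⊗ C ⊗ X) ⊗_B (Y ⊗ C ⊗ X)` given by `1 ⊗ Δ ⊗ 1` followed by
the coevaluation inserted in the middle. -/
def canonicalComul (adj : Bicategory.Adjunction x y) : y ≫ C.X ≫ x ⟶ (y ≫ C.X ≫ x) ≫ (y ≫ C.X ≫ x) :=
  y ◁ Comonad.comul (t := C.X) ▷ x ⊗≫ (y ≫ C.X) ◁ adj.unit ▷ (C.X ≫ x) ⊗≫ 𝟙 _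
/-- The counit `Y ⊗_A C ⊗_A X ⟶ Y ⊗_A X ⟶ B`. -/
def canonicalCounit (adj : Bicategory.Adjunction x y) : y ≫ C.X ≫ x ⟶ 𝟙 b :=
  y ◁ Comonad.counit (t := C.X) ▷ x ⊗≫ adj.counit

theorem canonical_counit_comul (adj : Bicategory.Adjunction x y) :
    canonicalComul C adj ≫ canonicalCounit C adj ▷ (y ≫ C.X ≫ x) = (λ_ _).inv := by
  calc
    _ = y ◁ Comonad.comul (t := C.X) ▷ x ⊗≫
          y ◁ (C.X ◁ adj.unit ≫ Comonad.counit (t := C.X) ▷ (x ≫ y)) ▷ (C.X ≫ x) ⊗≫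
            adj.counit ▷ y ▷ (C.X ≫ x) ⊗≫ 𝟙 _ := by
      dsimp only [canonicalComul, canonicalCounit]; bicategory
    _ = y ◁ (Comonad.comul (t := C.X) ≫ Comonad.counit (t := C.X) ▷ C.X) ▷ x ⊗≫
          rightZigzag adj.unit adj.counit ▷ (C.X ≫ x) ⊗≫ 𝟙 _ := by
      rw [whisker_exchange]; dsimp only [rightZigzag]; bicategory
    _ = (λ_ _).inv := by
      rw [Comonad.counit_comul, adj.right_triangle]; bicategory

theorem canonical_comul_counit (adj : Bicategory.Adjunction x y) :
    canonicalComul C adj ≫ (y ≫ C.X ≫ x) ◁ canonicalCounit C adj = (ρ_ _).inv := by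
  calc
    _ = y ◁ Comonad.comul (t := C.X) ▷ x ⊗≫
          (y ≫ C.X) ◁ (adj.unit ▷ C.X ≫ (x ≫ y) ◁ Comonad.counit (t := C.X)) ▷ x ⊗≫
            (y ≫ C.X) ◁ x ◁ adj.counit ⊗≫ 𝟙 _ := by
      dsimp only [canonicalComul, canonicalCounit]; bicategory
    _ = y ◁ (Comonad.comul (t := C.X) ≫ C.X ◁ Comonad.counit (t := C.X)) ▷ x ⊗≫
          (y ≫ C.X) ◁ leftZigzag adj.unit adj.counit ⊗≫ 𝟙 _ := by
      rw [← whisker_exchange]; dsimp only [leftZigzag]; bicategory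
    _ = (ρ_ _).inv := by
      rw [Comonad.comul_counit, adj.left_triangle]; bicategory

theorem canonical_comul_assoc (adj : Bicategory.Adjunction x y) :
    canonicalComul C adj ≫ (y ≫ C.X ≫ x) ◁ canonicalComul C adj =
      canonicalComul C adj ≫ canonicalComul C adj ▷ (y ≫ C.X ≫ x) ≫ (α_ _ _ _).hom := by
  calc
    _ = y ◁ Comonad.comul (t := C.X) ▷ x ⊗≫
          (y ≫ C.X) ◁ (adj.unit ▷ C.X ≫ (x ≫ y) ◁ Comonad.comul (t := C.X)) ▷ x ⊗≫
            (y ≫ C.X ≫ x ≫ y ≫ C.X) ◁ adj.unit ▷ (C.X ≫ x) ⊗≫ 𝟙 _ := by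
      dsimp only [canonicalComul]; bicategory
    _ = y ◁ (Comonad.comul (t := C.X) ≫ C.X ◁ Comonad.comul (t := C.X)) ▷ x ⊗≫
          (y ≫ C.X) ◁ (adj.unit ▷ (C.X ≫ 𝟙 a) ≫ (x ≫ y) ◁ C.X ◁ adj.unit) ▷ (C.X ≫ x) ⊗≫ 𝟙 _ := by
      rw [← whisker_exchange]; bicategory
    _ = y ◁ Comonad.comul (t := C.X) ▷ x ⊗≫
          y ◁ (Comonad.comul (t := C.X) ▷ (𝟙 a) ≫ (C.X ≫ C.X) ◁ adj.unit) ▷ (C.X ≫ x) ⊗≫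
          (y ≫ C.X) ◁ adj.unit ▷ (C.X ≫ (x ≫ y) ≫ C.X ≫ x) ⊗≫ 𝟙 _ := by
      rw [Comonad.comul_assoc, ← whisker_exchange]; bicategory
    _ = _ := by
      rw [← whisker_exchange]
      dsimp only [canonicalComul]; bicategory

/-- The canonical coring `X_*(C) = Y ⊗_A C ⊗_A X`, where `Y` is the right dual of `X`. -/
def canonicalCoring (adj : Bicategory.Adjunction x y) : Comon (b ⟶ b) where
  X := y ≫ C.X ≫ x
  comon :=
    { counit := canonicalCounit C adj
      comul := canonicalComul C adj
      counit_comul := canonical_counit_comul C adj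
      comul_counit := canonical_comul_counit C adj
      comul_assoc := canonical_comul_assoc C adj }

/-- The universal braiding `u ⊗ 1 : C ⊗_A X ⟶ X ⊗_B X_*(C)`. -/
def universalBraiding (adj : Bicategory.Adjunction x y) : Braiding C (canonicalCoring C adj) x where
  hom := (λ_ _).inv ≫ adj.unit ▷ (C.X ≫ x) ≫ (α_ x y (C.X ≫ x)).hom
  pentagon := by
    change _ = _ ≫ x ◁ canonicalComul C adj
    change Comonad.comul (t := C.X) ▷ x ≫ (α_ C.X C.X x).hom ≫ C.X ◁ _ ≫
      (α_ C.X x (y ≫ C.X ≫ x)).inv ≫ _ ▷ (y ≫ C.X ≫ x) ≫ (α_ x (y ≫ C.X ≫ x) (y ≫ C.X ≫ x)).hom = _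
    symm
    calc
      _ = 𝟙 _ ⊗≫ (adj.unit ▷ C.X ≫ (x ≫ y) ◁ Comonad.comul (t := C.X)) ▷ x ⊗≫
          (x ≫ y ≫ C.X) ◁ adj.unit ▷ (C.X ≫ x) ⊗≫ 𝟙 _ := by
        dsimp only [canonicalComul]; bicategory
      _ = 𝟙 _ ⊗≫ Comonad.comul (t := C.X) ▷ x ⊗≫
          (adj.unit ▷ (C.X ≫ 𝟙 a) ≫ (x ≫ y) ◁ C.X ◁ adj.unit) ▷ (C.X ≫ x) ⊗≫ 𝟙 _ := by
        rw [← whisker_exchange]; bicategory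
      _ = _ := by
        rw [← whisker_exchange]; bicategory
  counit_comp := by
    change _ ≫ x ◁ canonicalCounit C adj ≫ _ = _
    calc
      _ = 𝟙 _ ⊗≫ (adj.unit ▷ C.X ≫ (x ≫ y) ◁ Comonad.counit (t := C.X)) ▷ x ⊗≫
          x ◁ adj.counit ⊗≫ 𝟙 _ := by
        dsimp only [canonicalCounit]; bicategory
      _ = Comonad.counit (t := C.X) ▷ x ⊗≫ leftZigzag adj.unit adj.counit ⊗≫ 𝟙 _ := by
        rw [← whisker_exchange]; dsimp only [leftZigzag]; bicategory
      _ = _ := by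
        rw [adj.left_triangle]; bicategory

variable {C} {D : Comon (b ⟶ b)}

/-- The structure map `M ⟶ M ⊗_A C` of a comodule. -/
def coaction {e : B} (M : (comodComonad e C).Coalgebra) : M.A ⟶ M.A ≫ C.X := M.a

/-- The coaction `M ⊗_A X ⟶ M ⊗_A C ⊗_A X ⟶ M ⊗_A X ⊗_B D` induced by a braiding. -/
def inducedCoaction (e : B) (T : Braiding C D x) (M : (comodComonad e C).Coalgebra) :
    M.A ≫ x ⟶ (M.A ≫ x) ≫ D.X :=
  coaction M ▷ x ≫ (α_ M.A C.X x).hom ≫ M.A ◁ T.hom ≫ (α_ M.A x D.X).inv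

/-- The functor `T_*` from `C`-comodules to `D`-comodules governed by a braiding `T` on `X`; its
underlying functor is `- ⊗_A X`. -/
def inducedFunctor (e : B) (T : Braiding C D x) :
    (comodComonad e C).Coalgebra ⥤ (comodComonad e D).Coalgebra where
  obj M :=
    { A := M.A ≫ x
      a := inducedCoaction e T M
      counit := by
        have h : coaction M ≫ M.A ◁ Comonad.counit (t := C.X) ≫ (ρ_ M.A).hom = 𝟙 _ := M.counit
        change inducedCoaction e T M ≫ (M.A ≫ x) ◁ Comonad.counit (t := D.X) ≫ (ρ_ (M.A ≫ x)).hom = 𝟙 _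
        calc
          _ = coaction M ▷ x ⊗≫
              M.A ◁ (T.hom ≫ x ◁ Comonad.counit (t := D.X) ≫ (ρ_ x).hom) ⊗≫ 𝟙 _ := by
            dsimp only [inducedCoaction]; bicategory
          _ = (coaction M ≫ M.A ◁ Comonad.counit (t := C.X) ≫ (ρ_ M.A).hom) ▷ x := by
            rw [T.counit_comp]; bicategory
          _ = _ := by rw [h]; bicategory
      coassoc := by
        have h : coaction M ≫ M.A ◁ Comonad.comul (t := C.X) ≫ (α_ M.A C.X C.X).inv =
          coaction M ≫ coaction M ▷ C.X := M.coassoc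
        change inducedCoaction e T M ≫ (M.A ≫ x) ◁ Comonad.comul (t := D.X) ≫ (α_ (M.A ≫ x) D.X D.X).inv =
          inducedCoaction e T M ≫ inducedCoaction e T M ▷ D.X
        calc
          _ = coaction M ▷ x ⊗≫
              M.A ◁ (T.hom ≫ x ◁ Comonad.comul (t := D.X)) ⊗≫ 𝟙 _ := by
            dsimp only [inducedCoaction]; bicategory
          _ = (coaction M ≫ M.A ◁ Comonad.comul (t := C.X) ≫
                (α_ M.A C.X C.X).inv) ▷ x ⊗≫ M.A ◁ C.X ◁ T.hom ⊗≫ M.A ◁ T.hom ▷ D.X ⊗≫ 𝟙 _ := by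
            rw [← T.pentagon]; bicategory
          _ = coaction M ▷ x ⊗≫
               (coaction M ▷ (C.X ≫ x) ≫ (M.A ≫ C.X) ◁ T.hom) ⊗≫
                M.A ◁ T.hom ▷ D.X ⊗≫ 𝟙 _ := by
            rw [h]; bicategory
          _ = _ := by
            rw [← whisker_exchange]; dsimp only [inducedCoaction]; bicategory }
  map {M N} f :=
    { f := f.f ▷ x
      h := by
        have h : coaction M ≫ f.f ▷ C.X = f.f ≫ coaction N := f.h
        change inducedCoaction e T M ≫ f.f ▷ x ▷ D.X = f.f ▷ x ≫ inducedCoaction e T N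
        calc
          _ = coaction M ▷ x ⊗≫ (M.A ◁ T.hom ≫ f.f ▷ (x ≫ D.X)) ⊗≫ 𝟙 _ := by
            dsimp only [inducedCoaction]; bicategory
          _ = (coaction M ≫ f.f ▷ C.X) ▷ x ⊗≫ N.A ◁ T.hom ⊗≫ 𝟙 _ := by
            rw [whisker_exchange]; bicategory
          _ = _ := by
            rw [h]; dsimp only [inducedCoaction]; bicategory }
  map_id M := by
    apply CategoryTheory.Comonad.Coalgebra.Hom.ext
    exact id_whiskerRight _ _
  map_comp f g := by
    apply CategoryTheory.Comonad.Coalgebra.Hom.ext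
    exact comp_whiskerRight _ _ _

/-- The functor `(T^univ)_*` from `C`-comodules to `X_*(C)`-comodules. -/
def canonicalFunctor (e : B) (C : Comon (a ⟶ a)) (adj : Bicategory.Adjunction x y) :
    (comodComonad e C).Coalgebra ⥤ (comodComonad e (canonicalCoring C adj)).Coalgebra :=
  inducedFunctor e (universalBraiding C adj)

end Bicat

/-! Model categories. -/

section Model

open Limits MonoidalCategory HomotopicalAlgebra

instance (V : Type u) [Category.{v} V] [ModelCategory V] : HasCoequalizers V :=
  hasColimitsOfShape_of_hasFiniteColimits V WalkingParallelPair

/-- The pushout-product `K ⊗ Y ⊔_{K ⊗ X} L ⊗ X ⟶ L ⊗ Y` of `j : K ⟶ L` and `i : X ⟶ Y`. -/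
noncomputable def pushoutProduct {V : Type u} [Category.{v} V] [MonoidalCategory V] [HasPushouts V]
    {K L X Y : V} (j : K ⟶ L) (i : X ⟶ Y) : pushout (K ◁ i) (j ▷ X) ⟶ L ⊗ Y :=
  pushout.desc (j ▷ Y) (L ◁ i) (whisker_exchange j i)

/-- The compatibility axiom of a (closed) symmetric monoidal model category: pushout-products of
cofibrations have the left lifting property against fibrations, as soon as at least one of the
three morphisms is a weak equivalence. -/
class IsMonoidalModelCategory (V : Type u) [Category.{v} V] [MonoidalCategory V]
    [SymmetricCategory V] [MonoidalClosed V] [ModelCategory V] : Prop where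
  hasLiftingProperty {K L X Y E F : V} (j : K ⟶ L) (i : X ⟶ Y) (p : E ⟶ F)
    [Cofibration j] [Cofibration i] [Fibration p] :
    WeakEquivalence j ∨ WeakEquivalence i ∨ WeakEquivalence p →
      HasLiftingProperty (pushoutProduct j i) p

/-- A left adjoint functor between model categories is left Quillen if it preserves cofibrations
and trivial cofibrations. -/
structure IsLeftQuillen {M : Type*} [Category* M] {N : Type*} [Category* N]
    [ModelCategory M] [ModelCategory N] (F : M ⥤ N) : Prop where
  isLeftAdjoint : F.IsLeftAdjoint
  cofibration {X Y : M} (f : X ⟶ Y) : Cofibration f → Cofibration (F.map f)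
  trivialCofibration {X Y : M} (f : X ⟶ Y) : Cofibration f → WeakEquivalence f →
    Cofibration (F.map f) ∧ WeakEquivalence (F.map f)

/-- An adjunction `F ⊣ G` between model categories is a Quillen equivalence if `F` is left Quillen
and, for `X` cofibrant and `Y` fibrant, a morphism `F X ⟶ Y` is a weak equivalence if and only if
its adjunct `X ⟶ G Y` is one. -/
structure IsQuillenEquivalence {M : Type*} [Category* M] {N : Type*} [Category* N]
    [ModelCategory M] [ModelCategory N] {F : M ⥤ N} {G : N ⥤ M}
    (adj : CategoryTheory.Adjunction F G) : Prop where
  isLeftQuillen : IsLeftQuillen F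
  weakEquivalence_iff {X : M} {Y : N} [IsCofibrant X] [IsFibrant Y] (f : F.obj X ⟶ Y) :
    WeakEquivalence f ↔ WeakEquivalence (adj.homEquiv X Y f)

end Model

/-! Algebras, modules and comodules in a closed symmetric monoidal category. -/

section Alg

open Limits MonoidalCategory HomotopicalAlgebra

/-- Forget the right action: an `A`-`B`-bimodule viewed as an `A`-`𝟙`-bimodule. -/
def forgetRight {V : Type u} [Category.{v} V] [MonoidalCategory V] (A B : Mon V)
    (X : Bimod A B) : Bimod A (Mon.trivial V) where
  X := X.X
  actLeft := X.actLeft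
  one_actLeft := X.one_actLeft
  left_assoc := X.left_assoc
  actRight := (ρ_ X.X).hom
  actRight_one := by
    change X.X ◁ 𝟙 (𝟙_ V) ≫ (ρ_ X.X).hom = (ρ_ X.X).hom
    simp
  right_assoc := by
    change X.X ◁ (λ_ (𝟙_ V)).hom ≫ (ρ_ X.X).hom =
      (α_ X.X (𝟙_ V) (𝟙_ V)).inv ≫ (ρ_ X.X).hom ▷ 𝟙_ V ≫ (ρ_ X.X).hom
    monoidal
  middle_assoc := by
    change X.actLeft ▷ 𝟙_ V ≫ (ρ_ X.X).hom =
      (α_ A.X X.X (𝟙_ V)).hom ≫ A.X ◁ (ρ_ X.X).hom ≫ X.actLeft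
    simp

variable (V : Type u) [Category.{v} V] [MonoidalCategory V] [SymmetricCategory V]
  [MonoidalClosed V] [HasCoequalizers V]

/-- Algebras (monoids) in `V`; as a bicategory, its 1-morphisms `A ⟶ B` are the `A`-`B`-bimodules,
composed by the relative tensor product, and its 2-morphisms are the morphisms of bimodules. -/
def Alg := Mon V

noncomputable instance : Bicategory (Alg V) := Bimod.monBicategory (C := V)

/-- The unit of `V`, as an algebra. -/
def unitAlg : Alg V := Mon.trivial V

variable {V}

/-- The category `V_A` of right `A`-modules, as `𝟙`-`A`-bimodules; the left action of the unit
carries no information, see `unit_actLeft`. -/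
abbrev RightMod (A : Alg V) := unitAlg V ⟶ A

/-- Left `A`-modules, as `A`-`𝟙`-bimodules. -/
abbrev LeftMod (A : Alg V) := A ⟶ unitAlg V

theorem unit_actLeft {A : Alg V} (M : RightMod A) :
    Bimod.actLeft (A := Mon.trivial V) (B := (A : Mon V)) M =
      (λ_ (Bimod.X (A := Mon.trivial V) (B := (A : Mon V)) M)).hom := by
  have h := Bimod.one_actLeft (A := Mon.trivial V) (B := (A : Mon V)) M
  rw [← h]
  exact ((congrArg (· ≫ _) (id_whiskerRight _ _)).trans (Category.id_comp _)).symm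

/-- The functor sending a bimodule to its underlying object of `V`. -/
def underlying (A B : Alg V) : (A ⟶ B) ⥤ V := Bimod.forget (A : Mon V) (B := (B : Mon V))

/-- The left `A`-module underlying an `A`-`B`-bimodule. -/
def leftModule {A B : Alg V} (X : A ⟶ B) : LeftMod A :=
  forgetRight (A : Mon V) (B : Mon V) X

/-- The functor `- ⊗_A X : V_A ⥤ V_B` for an `A`-`B`-bimodule `X`. -/
noncomputable def tensorBimodule {A B : Alg V} (X : A ⟶ B) : RightMod A ⥤ RightMod B :=
  Bicategory.postcomp (unitAlg V) X

/-- The functor `- ⊗_A N : V_A ⥤ V` for a left `A`-module `N`. -/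
noncomputable def tensorLeftModule {A : Alg V} (N : LeftMod A) : RightMod A ⥤ V :=
  Bicategory.postcomp (unitAlg V) N ⋙ underlying (unitAlg V) (unitAlg V)

/-- A left `A`-module `N` is flat if `- ⊗_A N : V_A ⥤ V` preserves coreflexive equalizers. -/
def IsFlat {A : Alg V} (N : LeftMod A) : Prop :=
  ∀ ⦃M M' : RightMod A⦄ (f g : M ⟶ M'), IsCoreflexivePair f g →
    PreservesLimit (parallelPair f g) (tensorLeftModule N)

/-- An `A`-coring: a comonoid in the monoidal category of `A`-bimodules. -/
abbrev Coring (A : Alg V) := Comon (A ⟶ A)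

/-- A coring `(A, C)` is flat if `C` is flat as a left `A`-module. -/
def Coring.IsFlat {A : Alg V} (C : Coring A) : Prop := HomotopicDescent.IsFlat (leftModule C.X)

/-- The category `V_A^C` of right `(A, C)`-comodules. -/
abbrev Comod {A : Alg V} (C : Coring A) := (comodComonad (unitAlg V) C).Coalgebra

/-- The forgetful functor from `V_A^C` to `V_A`. -/
noncomputable abbrev forgetComod {A : Alg V} (C : Coring A) : Comod C ⥤ RightMod A :=
  (comodComonad (unitAlg V) C).forget

/-- The functor `Can_X` from `V_A^C` to `V_B^{X_*(C)}`, for an `A`-`B`-bimodule `X` with right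
dual `Y`. -/
noncomputable abbrev can {A B : Alg V} (C : Coring A) {X : A ⟶ B} {Y : B ⟶ A}
    (dual : Bicategory.Adjunction X Y) : Comod C ⥤ Comod (canonicalCoring C dual) :=
  canonicalFunctor (unitAlg V) C dual

end Alg

/-! Homotopical notions. -/

section Homotopy

open Limits MonoidalCategory HomotopicalAlgebra

variable {V : Type u} [Category.{v} V] [MonoidalCategory V] [SymmetricCategory V]
  [MonoidalClosed V] [ModelCategory V]

variable {A : Alg V} [ModelCategory (RightMod A)]

/-- `- ⊗_A N : V_A ⥤ V` preserves weak equivalences. -/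
def IsHomotopyFlat (N : LeftMod A) : Prop :=
  ∀ ⦃M M' : RightMod A⦄ (f : M ⟶ M'), WeakEquivalence f →
    WeakEquivalence ((tensorLeftModule N).map f)

/-- `N` is homotopy flat and the natural map `(lim Φ) ⊗_A N ⟶ lim (Φ ⊗_A N)` is a weak equivalence
for every finite diagram `Φ` of right `A`-modules. -/
def IsStronglyHomotopyFlat (N : LeftMod A) : Prop :=
  IsHomotopyFlat N ∧
    ∀ (J : Type) [SmallCategory J] [FinCategory J] (Φ : J ⥤ RightMod A),
      WeakEquivalence (limit.post Φ (tensorLeftModule N))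

/-- `- ⊗_A N : V_A ⥤ V` reflects weak equivalences. -/
def IsHomotopyFaithful (N : LeftMod A) : Prop :=
  ∀ ⦃M M' : RightMod A⦄ (f : M ⟶ M'), WeakEquivalence ((tensorLeftModule N).map f) →
    WeakEquivalence f

/-- `N` is homotopy faithful and strongly homotopy flat. -/
def IsHomotopyFaithfullyFlat (N : LeftMod A) : Prop :=
  IsHomotopyFaithful N ∧ IsStronglyHomotopyFlat N

/-- The bimodule `X`, with right dual `Y`, satisfies effective homotopic descent with respect to
`(A, C)`: the functor `Can_X` has a right adjoint `Prim_X`, and the adjunction is a Quillen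
equivalence. -/
def EffectiveHomotopicDescent {A B : Alg V} (C : Coring A) {X : A ⟶ B} {Y : B ⟶ A}
    (dual : Bicategory.Adjunction X Y) [ModelCategory (Comod C)]
    [ModelCategory (Comod (canonicalCoring C dual))] : Prop :=
  ∃ (prim : Comod (canonicalCoring C dual) ⥤ Comod C)
    (adj : CategoryTheory.Adjunction (can C dual) prim), IsQuillenEquivalence adj

end Homotopy

end HomotopicDescent

open HomotopicalAlgebra HomotopicDescent

/-! Weak equivalences of comodules are detected in `V`, where `Can_X` becomes `- ⊗_A X`; homotopy
faithful flatness therefore makes `Can_X` preserve and reflect them. By two-out-of-three, the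
Quillen equivalence reduces to the counit of `Can_X ⊣ Prim_X` being a weak equivalence
(`weakEquivalence_counit`).

At a cofree `X_*(C)`-comodule the counit is an isomorphism: the cofree `C`-comodule on `P ⊗_B Y` is
sent by `Can_X` to the cofree comodule on `P`, and universally so (`canonicalCofree_bijective`). A
general comodule is a coreflexive equalizer of cofree ones. `Prim_X` preserves it, being a right
adjoint; the forgetful functor to `V_A` preserves its image because `C` is flat; and `- ⊗_A X`
preserves the result up to weak equivalence by strong homotopy flatness. `Prim_X` itself comes from
the adjoint triangle theorem. -/

namespace HomotopicDescent
open Limits HomotopicalAlgebra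

/-! ### Equalizers preserved up to weak equivalence -/

section ModelLemmas

universe v₁ u₁

variable {M : Type u₁} [Category.{v₁} M] {V : Type u} [Category.{v} V]

/-- If the comparison map `T (lim Φ) ⟶ lim (T Φ)` of a parallel pair is a weak equivalence, then so
is any map from the image of a limit fork to a limit fork on an isomorphic pair. -/
theorem weakEquivalence_of_post_parallelPair [ModelCategory M] [ModelCategory V]
    (T : M ⥤ V) {a b : M} {f g : a ⟶ b}
    (hT : WeakEquivalence (limit.post (parallelPair f g) T))
    {s : Fork f g} (hs : IsLimit s) {a' b' : V} {f' g' : a' ⟶ b'} {s' : Fork f' g'}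
    (hs' : IsLimit s') (ea : T.obj a ≅ a') (eb : T.obj b ≅ b')
    (hf : T.map f ≫ eb.hom = ea.hom ≫ f') (hg : T.map g ≫ eb.hom = ea.hom ≫ g')
    (k : T.obj s.pt ⟶ s'.pt) (hk : k ≫ s'.ι = T.map s.ι ≫ ea.hom) :
    WeakEquivalence k := by
  let e : parallelPair f g ⋙ T ≅ parallelPair f' g' :=
    NatIso.ofComponents (fun | .zero => ea | .one => eb) (by
      rintro _ _ (_ | _ | _)
      · exact hf
      · exact hg
      · simp)
  let e₁ : T.obj s.pt ≅ T.obj (limit (parallelPair f g)) :=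
    T.mapIso (hs.conePointUniqueUpToIso (limit.isLimit _))
  let e₂ : s'.pt ≅ limit (parallelPair f g ⋙ T) :=
    (IsLimit.conePointsIsoOfNatIso (limit.isLimit _) hs' e).symm
  -- `k` is the canonical comparison map up to isomorphisms on both sides; this is tested against
  -- the fork `s'`.
  have h : k = e₁.hom ≫ limit.post (parallelPair f g) T ≫ e₂.inv := by
    apply Fork.IsLimit.hom_ext hs'
    have h₂ : e₂.inv ≫ s'.ι = limit.π (parallelPair f g ⋙ T) .zero ≫ ea.hom :=
      IsLimit.conePointsIsoOfNatIso_hom_comp (limit.isLimit _) hs' e .zero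
    have h₁ : e₁.hom ≫ T.map (limit.π (parallelPair f g) .zero) = T.map s.ι := by
      rw [Functor.mapIso_hom, ← T.map_comp]
      exact congrArg T.map (hs.conePointUniqueUpToIso_hom_comp (limit.isLimit _) .zero)
    rw [hk, Category.assoc, Category.assoc, h₂]
    erw [limit.post_π_assoc]
    rw [reassoc_of% h₁]
  rw [h]
  infer_instance

end ModelLemmas

/-! ### Coalgebras over a comonad: equalizers and adjoints -/

section ComonadLemmas

universe v₁ u₁ v₂ u₂

variable {A : Type u₁} [Category.{v₁} A] {B : Type u₂} [Category.{v₂} B]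

theorem isCoreflexivePair_map (F : A ⥤ B) {M N : A} (f g : M ⟶ N) [IsCoreflexivePair f g] :
    IsCoreflexivePair (F.map f) (F.map g) := by
  obtain ⟨r, hf, hg⟩ := IsCoreflexivePair.common_retraction f g
  exact .mk' (F.map r) (by rw [← F.map_comp, hf, F.map_id]) (by rw [← F.map_comp, hg, F.map_id])

/-- The forgetful functor of a comonad which preserves coreflexive equalizers preserves
coreflexive equalizers. -/
theorem preservesLimit_forget_of_coreflexive (G : Comonad A) [HasEqualizers A]
    (hG : ∀ ⦃M N : A⦄ (f g : M ⟶ N), IsCoreflexivePair f g →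
      PreservesLimit (parallelPair f g) (G : A ⥤ A))
    {M N : G.Coalgebra} (f g : M ⟶ N) [IsCoreflexivePair f g] :
    PreservesLimit (parallelPair f g) G.forget := by
  have h₁ : IsCoreflexivePair (G.forget.map f) (G.forget.map g) :=
    isCoreflexivePair_map G.forget f g
  have h₂ := isCoreflexivePair_map (G : A ⥤ A) (G.forget.map f) (G.forget.map g)
  let i₁ : parallelPair (G.forget.map f) (G.forget.map g) ≅ parallelPair f g ⋙ G.forget :=
    (diagramIsoParallelPair (parallelPair f g ⋙ G.forget)).symm
  let i₂ : parallelPair ((G : A ⥤ A).map (G.forget.map f)) ((G : A ⥤ A).map (G.forget.map g)) ≅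
      (parallelPair f g ⋙ G.forget) ⋙ (G : A ⥤ A) :=
    (diagramIsoParallelPair ((parallelPair f g ⋙ G.forget) ⋙ (G : A ⥤ A))).symm
  have := hG _ _ h₁
  -- A comonadic forgetful functor preserves a limit once `G` preserves it and its image under `G`;
  -- that image is again a coreflexive pair.
  have := hG _ _ h₂
  have : PreservesLimit (parallelPair f g ⋙ G.forget) (G : A ⥤ A) :=
    preservesLimit_of_iso_diagram _ i₁
  have : PreservesLimit ((parallelPair f g ⋙ G.forget) ⋙ (G : A ⥤ A)) (G : A ⥤ A) :=
    preservesLimit_of_iso_diagram _ i₂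
  infer_instance

/-- A functor to a category of coalgebras has a right adjoint if its composite with the forgetful
functor has one and its source has coreflexive equalizers. -/
theorem isLeftAdjoint_of_comp_forget (D : Comonad B) (K : A ⥤ D.Coalgebra)
    [HasCoreflexiveEqualizers A] [(K ⋙ D.forget).IsLeftAdjoint] : K.IsLeftAdjoint :=
  -- The adjoint triangle theorem asks the unit at each coalgebra to be a regular monomorphism,
  -- which is Beck's equalizer.
  isLeftAdjoint_triangle_lift K D.adj fun N => by
    rw [Comonad.adj_unit]
    exact ⟨_, _, _, _, Comonad.beckCoalgebraEqualizer N⟩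

theorem homEquiv_cofree_symm_apply (G : Comonad A) (M : G.Coalgebra) (P : A)
    (h : M ⟶ G.cofree.obj P) : (G.adj.homEquiv M P).symm h = h.f ≫ G.ε.app P := by
  rw [Adjunction.homEquiv_counit, Comonad.adj_counit]
  rfl

/-- The counit of an adjunction is an isomorphism at any object which receives a universal arrow
that is an isomorphism. -/
theorem isIso_counit_of_universal {K : A ⥤ B} {P : B ⥤ A} (adj : K ⊣ P) {Q : A} {E : B}
    (t : K.obj Q ⟶ E) [IsIso t]
    (ht : ∀ M : A, Function.Bijective fun h : M ⟶ Q => K.map h ≫ t) :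
    IsIso (adj.counit.app E) := by
  -- Factor the counit through `t` as `K.map h ≫ t`. Then `h` is inverse to the adjunct of `t`, so
  -- the counit is a composite of isomorphisms.
  obtain ⟨h, hh⟩ := (ht (P.obj E)).2 (adj.counit.app E)
  have h₁ : h ≫ adj.homEquiv Q E t = 𝟙 _ := by
    rw [← adj.homEquiv_naturality_left, show K.map h ≫ t = _ from hh, adj.homEquiv_unit,
      adj.right_triangle_components]
  have h₂ : adj.homEquiv Q E t ≫ h = 𝟙 _ := by
    apply (ht Q).1
    change K.map (_ ≫ h) ≫ t = K.map (𝟙 _) ≫ t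
    rw [K.map_comp, Category.assoc, show K.map h ≫ t = _ from hh, ← adj.homEquiv_counit]
    simp
  have : IsIso h := ⟨_, h₁, h₂⟩
  rw [← show K.map h ≫ t = _ from hh]
  infer_instance

end ComonadLemmas

/-! ### The canonical functor and cofree comodules -/

section Universal
open Bicategory

variable {B : Type u} [Bicategory.{w, v} B] {a b : B} (e : B) (C : Comon (a ⟶ a))
  {x : a ⟶ b} {y : b ⟶ a} (adj : Bicategory.Adjunction x y)

/-- The associator `((P ⊗ Y) ⊗ C) ⊗ X ≅ P ⊗ (Y ⊗ C ⊗ X)`, as a morphism of comodules from the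
canonical functor at a cofree `C`-comodule to a cofree `X_*(C)`-comodule. -/
def canonicalCofree (P : e ⟶ b) :
    (canonicalFunctor e C adj).obj ((comodComonad e C).cofree.obj (P ≫ y)) ⟶
      (comodComonad e (canonicalCoring C adj)).cofree.obj P where
  f := (α_ (P ≫ y) C.X x).hom ≫ (α_ P y (C.X ≫ x)).hom
  h := by
    change (((P ≫ y) ◁ Comonad.comul (t := C.X) ≫ (α_ _ _ _).inv) ▷ x ≫
      (α_ ((P ≫ y) ≫ C.X) C.X x).hom ≫
      ((P ≫ y) ≫ C.X) ◁ ((λ_ _).inv ≫ adj.unit ▷ (C.X ≫ x) ≫ (α_ x y (C.X ≫ x)).hom) ≫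
      (α_ ((P ≫ y) ≫ C.X) x (y ≫ C.X ≫ x)).inv) ≫
      ((α_ (P ≫ y) C.X x).hom ≫ (α_ P y (C.X ≫ x)).hom) ▷ (y ≫ C.X ≫ x) =
      ((α_ (P ≫ y) C.X x).hom ≫ (α_ P y (C.X ≫ x)).hom) ≫
      P ◁ canonicalComul C adj ≫ (α_ P (y ≫ C.X ≫ x) (y ≫ C.X ≫ x)).inv
    -- Both sides are `1 ⊗ Δ ⊗ 1` followed by the same insertion of the unit, so only coherence
    -- remains.
    dsimp only [canonicalComul]
    bicategory

instance (P : e ⟶ b) : IsIso (canonicalCofree e C adj P) := by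
  have : IsIso ((comodComonad e (canonicalCoring C adj)).forget.map (canonicalCofree e C adj P)) :=
    inferInstanceAs (IsIso ((α_ (P ≫ y) C.X x).hom ≫ (α_ P y (C.X ≫ x)).hom))
  exact isIso_of_reflects_iso _ (comodComonad e (canonicalCoring C adj)).forget

/-- The morphism `canonicalCofree` is a universal arrow from the canonical functor. -/
theorem canonicalCofree_bijective (P : e ⟶ b) (M : (comodComonad e C).Coalgebra) :
    Function.Bijective fun h : M ⟶ (comodComonad e C).cofree.obj (P ≫ y) =>
      (canonicalFunctor e C adj).map h ≫ canonicalCofree e C adj P := by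
  -- Comodule maps from `M` to the cofree comodule on `P ⊗ Y` are maps `M ⟶ P ⊗ Y`, hence by duality
  -- maps `M ⊗ X ⟶ P`, hence comodule maps from `Can_X M` to the cofree comodule on `P`.
  let E := ((comodComonad e C).adj.homEquiv M (P ≫ y)).symm.trans
    (adj.homEquiv₂ (g := M.A) (h := P)).symm
  let E' := (comodComonad e (canonicalCoring C adj)).adj.homEquiv
    ((canonicalFunctor e C adj).obj M) P
  convert (E.trans E').bijective using 1
  funext h
  refine E'.symm_apply_eq.1 ?_
  have h₁ : h.f ▷ x ≫ ((α_ (P ≫ y) C.X x).hom ≫ (α_ P y (C.X ≫ x)).hom) ≫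
      P ◁ canonicalCounit C adj ≫ (ρ_ P).hom =
      (h.f ≫ (P ≫ y) ◁ Comonad.counit (t := C.X) ≫ (ρ_ (P ≫ y)).hom) ▷ x ≫
        (α_ P y x).hom ≫ P ◁ adj.counit ≫ (ρ_ P).hom := by
    dsimp only [canonicalCounit]
    bicategory
  rw [← Category.assoc] at h₁
  refine Eq.trans ?_ (h₁.trans ?_)
  · exact homEquiv_cofree_symm_apply _ _ _ _
  · exact congrArg adj.homEquiv₂.symm (homEquiv_cofree_symm_apply _ _ _ _).symm

/-- The counit of an adjunction `Can_X ⊣ Prim_X` is an isomorphism at cofree comodules. -/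
theorem isIso_counit_cofree
    {prim : (comodComonad e (canonicalCoring C adj)).Coalgebra ⥤ (comodComonad e C).Coalgebra}
    (adj' : canonicalFunctor e C adj ⊣ prim) (P : e ⟶ b) :
    IsIso (adj'.counit.app ((comodComonad e (canonicalCoring C adj)).cofree.obj P)) :=
  isIso_counit_of_universal adj' (canonicalCofree e C adj P)
    (canonicalCofree_bijective e C adj P)

end Universal

/-! ### Limits of modules and flatness -/

section Modules
open Limits MonoidalCategory HomotopicalAlgebra

/-- The forgetful functor from bimodules to the ambient category reflects limits. -/
theorem forget_reflectsLimit {V : Type u} [Category.{v} V] [MonoidalCategory V]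
    (A B : Mon V) {J : Type*} [Category* J] (F : J ⥤ Bimod A B) :
    ReflectsLimit F (Bimod.forget A (B := B)) where
  reflects {c} hc := by
    obtain ⟨hc⟩ : Nonempty (IsLimit ((Bimod.forget A (B := B)).mapCone c)) := ⟨hc⟩
    let l (s : Cone F) : s.pt.X ⟶ c.pt.X := hc.lift ((Bimod.forget A (B := B)).mapCone s)
    have fac (s : Cone F) (j : J) : l s ≫ (c.π.app j).hom = (s.π.app j).hom :=
      hc.fac ((Bimod.forget A (B := B)).mapCone s) j
    refine ⟨⟨fun s => ⟨l s, ?_, ?_⟩, ?_, ?_⟩⟩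
    -- The lift found in `V` is equivariant because the projections are equivariant and jointly
    -- monic.
    · refine hc.hom_ext fun j => ?_
      change (s.pt.actLeft ≫ l s) ≫ (c.π.app j).hom = (A.X ◁ l s ≫ c.pt.actLeft) ≫ (c.π.app j).hom
      have h : c.pt.actLeft ≫ (c.π.app j).hom = A.X ◁ (c.π.app j).hom ≫ (F.obj j).actLeft :=
        (c.π.app j).left_act_hom
      rw [Category.assoc, Category.assoc, fac, h, ← MonoidalCategory.whiskerLeft_comp_assoc, fac]
      exact (s.π.app j).left_act_hom
    · refine hc.hom_ext fun j => ?_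
      change (s.pt.actRight ≫ l s) ≫ (c.π.app j).hom = (l s ▷ B.X ≫ c.pt.actRight) ≫ (c.π.app j).hom
      have h : c.pt.actRight ≫ (c.π.app j).hom = (c.π.app j).hom ▷ B.X ≫ (F.obj j).actRight :=
        (c.π.app j).right_act_hom
      rw [Category.assoc, Category.assoc, fac, h, ← MonoidalCategory.comp_whiskerRight_assoc, fac]
      exact (s.π.app j).right_act_hom
    · intro s j
      exact Bimod.hom_ext _ _ (fac s j)
    · intro s m hm
      refine Bimod.hom_ext _ _ (hc.hom_ext fun j => ?_)
      exact (congrArg Bimod.Hom.hom (hm j)).trans (fac s j).symm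

variable {V : Type u} [Category.{v} V] [MonoidalCategory V] [SymmetricCategory V]
  [MonoidalClosed V] [HasCoequalizers V]

/-- If `X` is flat as a left `A`-module, then `- ⊗_A X : V_A ⥤ V_B` preserves coreflexive
equalizers. -/
theorem IsFlat.preservesLimit_tensorBimodule {A B : Alg V} {X : A ⟶ B}
    (hX : IsFlat (leftModule X)) {M N : RightMod A} (f g : M ⟶ N) (h : IsCoreflexivePair f g) :
    PreservesLimit (parallelPair f g) (tensorBimodule X) := by
  -- The object underlying `M ⊗_A X` depends only on the left action on `X`, so flatness applies
  -- definitionally.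
  have h₁ : PreservesLimit (parallelPair f g) (tensorBimodule X ⋙ underlying (unitAlg V) B) :=
    hX f g h
  have h₂ : ReflectsLimit (parallelPair f g ⋙ tensorBimodule X) (underlying (unitAlg V) B) :=
    forget_reflectsLimit _ _ _
  exact preservesLimit_of_reflects_of_preserves _ (underlying (unitAlg V) B)

end Modules
-- Existence of `Prim_X` and its counit
section Descent
open Limits HomotopicalAlgebra

variable {V : Type u} [Category.{v} V] [MonoidalCategory V] [SymmetricCategory V]
  [MonoidalClosed V] [ModelCategory V] {A B : Alg V}
  (C : Coring A) {X : A ⟶ B} {Y : B ⟶ A} (dual : Bicategory.Adjunction X Y)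

/-- The functor `Can_X` has a right adjoint as soon as `V_A^C` has coreflexive equalizers. -/
theorem isLeftAdjoint_can [HasCoreflexiveEqualizers (Comod C)]
    [(tensorBimodule X).IsLeftAdjoint] : (can C dual).IsLeftAdjoint := by
  have : (can C dual ⋙ forgetComod (canonicalCoring C dual)).IsLeftAdjoint :=
    inferInstanceAs (forgetComod C ⋙ tensorBimodule X).IsLeftAdjoint
  exact isLeftAdjoint_of_comp_forget (comodComonad (unitAlg V) (canonicalCoring C dual)) _

/-- If `C` is flat and `X` is strongly homotopy flat, then the counit of `Can_X ⊣ Prim_X` is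
a weak equivalence on underlying objects. -/
theorem weakEquivalence_counit [ModelCategory (RightMod A)] (hC : C.IsFlat)
    (hX : IsStronglyHomotopyFlat (leftModule X))
    {prim : Comod (canonicalCoring C dual) ⥤ Comod C}
    (adj : CategoryTheory.Adjunction (can C dual) prim) (N : Comod (canonicalCoring C dual)) :
    WeakEquivalence ((underlying (unitAlg V) B).map
      ((forgetComod (canonicalCoring C dual)).map (adj.counit.app N))) := by
  let D := canonicalCoring C dual
  let W : Comod D ⥤ V := forgetComod D ⋙ underlying (unitAlg V) B
  let f := Comonad.CofreeEqualizer.topMap N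
  let g := Comonad.CofreeEqualizer.bottomMap N
  let ι := Comonad.CofreeEqualizer.ι N
  have hι : ι ≫ f = ι ≫ g := Comonad.CofreeEqualizer.condition N
  have : IsCoreflexivePair f g := inferInstanceAs
    (IsCoreflexivePair (Comonad.CofreeEqualizer.topMap N) (Comonad.CofreeEqualizer.bottomMap N))
  have : IsCoreflexivePair (prim.map f) (prim.map g) := isCoreflexivePair_map prim f g
  have : PreservesLimit (parallelPair f g) prim :=
    (adj.rightAdjoint_preservesLimits).preservesLimitsOfShape.preservesLimit
  -- This is where flatness of `C` enters.
  have : PreservesLimit (parallelPair (prim.map f) (prim.map g)) (forgetComod C) :=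
    preservesLimit_forget_of_coreflexive _ (fun _ _ f g h => hC.preservesLimit_tensorBimodule f g h)
      _ _
  have hprim : IsLimit (Fork.ofι (f := prim.map f) (g := prim.map g) (prim.map ι)
      (by rw [← prim.map_comp, hι, prim.map_comp])) :=
    isLimitForkMapOfIsLimit prim hι (Comonad.beckCoalgebraEqualizer N)
  have hforget := isLimitForkMapOfIsLimit (forgetComod C) _ hprim
  -- Beck's equalizer is split on underlying modules, so every functor preserves it there.
  have hW : IsLimit (Fork.ofι (f := W.map f) (g := W.map g) (W.map ι)
      (by rw [← W.map_comp, hι, W.map_comp])) :=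
    ((Comonad.beckSplitEqualizer N).map (underlying (unitAlg V) B)).isEqualizer
  let ε (N) (h : IsIso (adj.counit.app N)) :
    W.obj ((can C dual).obj (prim.obj N)) ≅ W.obj N := W.mapIso (asIso (adj.counit.app N))
  -- The side conditions are naturality of the counit at `f`, `g` and `ι`.
  refine weakEquivalence_of_post_parallelPair (tensorLeftModule (leftModule X)) (hX.2 _ _)
    hforget hW (ε _ (isIso_counit_cofree _ C dual adj _)) (ε _ (isIso_counit_cofree _ C dual adj _))
    ?_ ?_ _ ?_
  · exact W.map_comp _ _ |>.symm.trans <| (congrArg W.map (adj.counit.naturality f)).trans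
      (W.map_comp _ _)
  · exact W.map_comp _ _ |>.symm.trans <| (congrArg W.map (adj.counit.naturality g)).trans
      (W.map_comp _ _)
  · exact W.map_comp _ _ |>.symm.trans <| (congrArg W.map (adj.counit.naturality ι).symm).trans
      (W.map_comp _ _)

end Descent
end HomotopicDescent

/-! ### The Quillen equivalence -/

open HomotopicalAlgebra HomotopicDescent
theorem mainTheorem2
    -- a closed symmetric monoidal model category
    {V : Type u} [Category.{v} V] [MonoidalCategory V] [SymmetricCategory V]
    [MonoidalClosed V] [ModelCategory V] [IsMonoidalModelCategory V]
    -- model structures on all categories of right modules, with underlying weak equivalences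
    [∀ A : Alg V, ModelCategory (RightMod A)]
    (weakEquivalence_mod : ∀ (A : Alg V) {M N : RightMod A} (f : M ⟶ N),
      WeakEquivalence f ↔ WeakEquivalence ((underlying (unitAlg V) A).map f))
    -- left-induced model structures on all categories of comodules
    [∀ (A : Alg V) (C : Coring A), ModelCategory (Comod C)]
    (weakEquivalence_comod : ∀ (A : Alg V) (C : Coring A) {M N : Comod C} (f : M ⟶ N),
      WeakEquivalence f ↔ WeakEquivalence ((forgetComod C).map f))
    (cofibration_comod : ∀ (A : Alg V) (C : Coring A) {M N : Comod C} (f : M ⟶ N),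
      Cofibration f ↔ Cofibration ((forgetComod C).map f))
    -- a flat coring `(A, C)` and a bimodule `X` with right dual `Y`
    (A B : Alg V) (C : Coring A) (hC : C.IsFlat)
    (X : A ⟶ B) (Y : B ⟶ A) (dual : Bicategory.Adjunction X Y)
    (hQuillen : IsLeftQuillen (tensorBimodule X))
    (hX : IsHomotopyFaithfullyFlat (leftModule X)) :
    EffectiveHomotopicDescent C dual := by
  have := hQuillen.isLeftAdjoint
  -- The model structure on `V_A^C` supplies the coreflexive equalizers.
  have : (can C dual).IsLeftAdjoint := isLeftAdjoint_can C dual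
  have cof {M N : Comod C} (f : M ⟶ N) (hf : Cofibration f) : Cofibration ((can C dual).map f) :=
    (cofibration_comod _ _ _).2 (hQuillen.cofibration _ ((cofibration_comod _ _ _).1 hf))
  have weq {M N : Comod C} (f : M ⟶ N) :
      WeakEquivalence ((can C dual).map f) ↔ WeakEquivalence f := by
    rw [weakEquivalence_comod, weakEquivalence_mod, weakEquivalence_comod]
    exact ⟨fun h => hX.1 ((forgetComod C).map f) h, fun h => hX.2.1 ((forgetComod C).map f) h⟩
  let adj := CategoryTheory.Adjunction.ofIsLeftAdjoint (can C dual)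
  refine ⟨_, adj, ⟨inferInstance, cof, fun f hf hf' => ⟨cof f hf, (weq f).2 hf'⟩⟩, ?_⟩
  intro M N _ _ f
  have : WeakEquivalence (adj.counit.app N) := by
    rw [weakEquivalence_comod, weakEquivalence_mod]
    exact weakEquivalence_counit C dual hC hX.2 adj N
  -- Now `f` is `Can_X g` followed by the counit, so two-out-of-three compares it with `Can_X g`,
  -- and `weq` with `g`.
  obtain ⟨g, rfl⟩ := (adj.homEquiv M N).symm.surjective f
  rw [Equiv.apply_symm_apply, adj.homEquiv_counit, weakEquivalence_postcomp_iff, weq]
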